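/- Let $(X,d)$ be a metric space and $A\subseteq X$. Suppose that $X$ deformation contracts onto $A$, that is, there is a continuous map $F\colon X\times[0,1]\to X$ such that $F(x,0)=x$, $F(x,1)\in A$ and $F(a,t)=a$ for all $x\in X$, $a\in A$, $t\in[0,1]$, and $$d(F(x,t'),F(y,t'))\le d(F(x,t),F(y,t))\qquad\text{for all } x,y\in X \text{ and } 0\le t<t'\le 1 .$$ For $B\subseteq X$ and $r>0$ let $\operatorname{Rips}(B,r)$ be the simplicial complex whose simplices are the nonempty finite sets $\sigma\subseteq B$ with $\operatorname{diam}(\sigma)<r$. For $B\subseteq X$, $W\subseteq X$ and $r>0$ let $\operatorname{Cech}_W(B,r)$ be the simplicial complex whose simplices are the nonempty finite sets $\sigma\subseteq B$ for which there is a point $w\in W$ with $d(z,w)<r$ for all $z\in\sigma$. Then, for every $r>0$, the inclusions $$\operatorname{Rips}(A,r)\hookrightarrow\operatorname{Rips}(X,r),\qquad \operatorname{Cech}_A(A,r)\hookrightarrow\operatorname{Cech}_X(X,r),\qquad \operatorname{Cech}_X(A,r)\hookrightarrow\operatorname{Cech}_X(X,r)$$ induce homotopy equivalences of geometric realizations (with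 the weak topology). -/

import Mathlib

/-- A continuous map is a homotopy equivalence if it is the underlying map of one, that is, if it
has a two-sided inverse up to homotopy. -/
def IsHomotopyEquivalence {Y Z : Type*} [TopologicalSpace Y] [TopologicalSpace Z]
    (f : C(Y, Z)) : Prop :=
  ∃ e : ContinuousMap.HomotopyEquiv Y Z, e.toFun = f

/-- `F : X × [0,1] → X` is a deformation contraction (a crushing, in Hausmann's terminology) of the
metric space `X` onto the subset `A`. -/
structure IsDeformationContraction {X : Type*} [MetricSpace X] (A : Set X)
    (F : C(X × unitInterval, X)) : Prop where
  apply_zero : ∀ x, F (x, 0) = x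
  apply_one_mem : ∀ x, F (x, 1) ∈ A
  apply_of_mem : ∀ a ∈ A, ∀ t, F (a, t) = a
  dist_le : ∀ x y, ∀ t t' : unitInterval, t < t' →
    dist (F (x, t')) (F (y, t')) ≤ dist (F (x, t)) (F (y, t))

/-- `X` deformation contracts onto `A`. -/
def DeformationContracts (X : Type*) [MetricSpace X] (A : Set X) : Prop :=
  ∃ F : C(X × unitInterval, X), IsDeformationContraction A F

section Complexes

variable {X : Type*} [MetricSpace X]

/-- The open Vietoris-Rips complex `Rips(A, r)` of the subset `A` of a metric space: its simplices
are the nonempty finite subsets of `A` of diameter less than `r`. -/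
def ripsComplex (A : Set X) (r : ℝ) : PreAbstractSimplicialComplex X where
  faces := {σ | σ.Nonempty ∧ (σ : Set X) ⊆ A ∧ Metric.diam (σ : Set X) < r}
  isRelLowerSet_faces := by
    rintro σ ⟨hne, hA, hd⟩
    refine ⟨hne, fun τ hτ hτne => ⟨hτne, ?_, ?_⟩⟩
    · exact (Finset.coe_subset.2 hτ).trans hA
    · exact (Metric.diam_mono (Finset.coe_subset.2 hτ) σ.finite_toSet.isBounded).trans_lt hd

/-- The open Čech complex `Cech_W(A, r)` of the subset `A`, with witnesses in `W`: its simplices are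
the nonempty finite subsets `σ` of `A` such that the open balls of radius `r` centred at the points
of `σ` have a common point in `W`. -/
def cechComplex (W A : Set X) (r : ℝ) : PreAbstractSimplicialComplex X where
  faces := {σ | σ.Nonempty ∧ (σ : Set X) ⊆ A ∧ (W ∩ ⋂ z ∈ σ, Metric.ball z r).Nonempty}
  isRelLowerSet_faces := by
    rintro σ ⟨hne, hA, hw⟩
    refine ⟨hne, fun τ hτ hτne => ⟨hτne, ?_, ?_⟩⟩
    · exact (Finset.coe_subset.2 hτ).trans hA
    · exact hw.mono (Set.inter_subset_inter_right W (Set.biInter_subset_biInter_left hτ))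

theorem ripsComplex_mono {A B : Set X} (h : A ⊆ B) (r : ℝ) :
    ripsComplex A r ≤ ripsComplex B r :=
  fun _ hσ => ⟨hσ.1, hσ.2.1.trans h, hσ.2.2⟩

theorem cechComplex_mono {V W A B : Set X} (hW : V ⊆ W) (h : A ⊆ B) (r : ℝ) :
    cechComplex V A r ≤ cechComplex W B r :=
  fun _ hσ => ⟨hσ.1, hσ.2.1.trans h, hσ.2.2.mono (Set.inter_subset_inter_left _ hW)⟩

end Complexes

namespace PreAbstractSimplicialComplex

variable {ι : Type*}

/-- The points of the geometric realization `|K|` of a simplicial complex, given by barycentric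
coordinates: finitely supported families of nonnegative weights with sum `1` whose support is a
face of `K`. -/
def Realization (K : PreAbstractSimplicialComplex ι) : Type _ :=
  {w : ι →₀ ℝ // (∀ v, 0 ≤ w v) ∧ (w.sum fun _ a => a) = 1 ∧ w.support ∈ K.faces}

/-- The canonical map from the standard simplex on the vertex set of a face `σ` of `K` to `|K|`,
which extends barycentric coordinates by zero. -/
noncomputable def simplexMap (K : PreAbstractSimplicialComplex ι) (σ : K.faces)
    (w : stdSimplex ℝ σ.1) : K.Realization :=
  ⟨(Finsupp.equivFunOnFinite.symm w.1).embDomain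
      (Function.Embedding.subtype _), by
    set u : σ.1 →₀ ℝ := Finsupp.equivFunOnFinite.symm w.1 with hu
    have hsum : (u.sum fun _ a => a) = 1 := by
      rw [Finsupp.sum_fintype _ _ fun _ => rfl]
      exact w.2.2
    refine ⟨fun v => ?_, ?_, ?_⟩
    · by_cases hv : v ∈ σ.1
      · have h := Finsupp.embDomain_apply_self (Function.Embedding.subtype (· ∈ σ.1))
          u ⟨v, hv⟩
        simp only [Function.Embedding.subtype_apply] at h
        rw [h]
        exact w.2.1 _
      · rw [Finsupp.embDomain_of_notMem_range]
        simpa using hv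
    · rw [Finsupp.sum_embDomain]
      exact hsum
    · refine (K.isRelLowerSet_faces σ.2).2 ?_ ?_
      · intro v hv
        rw [Finsupp.support_embDomain, Finset.mem_map] at hv
        obtain ⟨x, -, rfl⟩ := hv
        exact x.2
      · rw [Finsupp.support_embDomain, Finset.map_nonempty, Finsupp.support_nonempty_iff]
        intro h0
        rw [h0] at hsum
        simp at hsum⟩

/-- The weak (coherent) topology on `|K|`: a subset is open if and only if its preimage in every
closed simplex of `K`, with the Euclidean topology of that simplex, is open. -/
noncomputable instance instTopologicalSpaceRealization (K : PreAbstractSimplicialComplex ι) :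
    TopologicalSpace K.Realization :=
  ⨆ σ : K.faces, TopologicalSpace.coinduced (K.simplexMap σ) instTopologicalSpaceSubtype

/-- The continuous map `|K| → |L|` induced by the inclusion of a subcomplex `K` of `L`, which is
the identity on barycentric coordinates. -/
def realizationInclusion {K L : PreAbstractSimplicialComplex ι} (h : K ≤ L) :
    C(K.Realization, L.Realization) where
  toFun p := ⟨p.1, p.2.1, p.2.2.1, h p.2.2.2⟩
  continuous_toFun := by
    refine continuous_iSup_dom.2 fun σ => continuous_coinduced_dom.2 ?_
    have hL : Continuous (L.simplexMap ⟨σ, h σ.2⟩) :=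
      continuous_iff_coinduced_le.2
        (le_iSup (fun τ : L.faces => TopologicalSpace.coinduced (L.simplexMap τ) instTopologicalSpaceSubtype)
          ⟨σ, h σ.2⟩)
    exact hL

end PreAbstractSimplicialComplex

/-! The end map `F (·, 1)` does not increase distances, lands in `A` and fixes `A`, so it is a
simplicial retraction of the big complex `K` onto the subcomplex `L`. It remains to see that it is
homotopic to the identity on `|K|`. The strict inequality defining a face leaves room: vertices of a
fixed face `σ`, moved for nearly equal times, still span a face (`rips_short_tracks`,
`cech_short_tracks`), but the tolerance depends on `σ` and need not be bounded below over `K`.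

The homotopy therefore moves mass along time grids `j / n τ`, using hat functions in time, with `n`
increasing in the face `τ`, and blends the grids with weights `faceWeight τ`. Using only the carrier
of `p` would be discontinuous, since carriers jump. Instead only the truncated coordinates `p.trunc`
are moved, and `faceWeight τ` vanishes unless `p.trunc.support ⊆ τ ⊆ p.1.support`. Each grid in play
is then fine enough for the vertices being moved (`truncMap_homotopic_comp`). Truncation is itself
homotopic to the identity (`id_homotopic_truncMap`), and
`isHomotopyEquivalence_realizationInclusion` assembles the pieces. -/

namespace PreAbstractSimplicialComplex

variable {ι : Type*} {K L : PreAbstractSimplicialComplex ι}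

/-! ### Continuity for the weak topology. -/

theorem continuous_simplexMap (σ : K.faces) : Continuous (K.simplexMap σ) :=
  continuous_iff_coinduced_le.2
    (le_iSup (fun τ : K.faces =>
      TopologicalSpace.coinduced (K.simplexMap τ) instTopologicalSpaceSubtype) σ)

theorem continuous_realization_dom {T : Type*} [TopologicalSpace T] {g : K.Realization → T}
    (h : ∀ σ, Continuous fun w => g (K.simplexMap σ w)) : Continuous g :=
  continuous_iSup_dom.2 fun σ => continuous_coinduced_dom.2 (h σ)

theorem simplexMap_apply_of_mem (σ : K.faces) (w : stdSimplex ℝ σ.1) {v : ι} (hv : v ∈ σ.1) :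
    (K.simplexMap σ w).1 v = w.1 ⟨v, hv⟩ :=
  Finsupp.embDomain_apply_self (Function.Embedding.subtype (· ∈ σ.1))
    (Finsupp.equivFunOnFinite.symm w.1) ⟨v, hv⟩

theorem simplexMap_apply_of_notMem (σ : K.faces) (w : stdSimplex ℝ σ.1) {v : ι} (hv : v ∉ σ.1) :
    (K.simplexMap σ w).1 v = 0 := by
  refine Finsupp.embDomain_of_notMem_range _ _ _ ?_
  simpa using hv

theorem support_simplexMap_subset (σ : K.faces) (w : stdSimplex ℝ σ.1) :
    (K.simplexMap σ w).1.support ⊆ σ.1 := fun v hv => by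
  by_contra h
  exact Finsupp.mem_support_iff.1 hv (simplexMap_apply_of_notMem σ w h)

theorem Realization.sum_eq_one_of_subset (p : K.Realization) {S : Finset ι}
    (hS : p.1.support ⊆ S) : ∑ v ∈ S, p.1 v = 1 := by
  exact (Finsupp.sum_of_support_subset _ hS _ fun _ _ => rfl).symm.trans p.2.2.1

/-- The barycentric coordinates of a point of `|K|` on a simplex containing it. -/
def Realization.toSimplex (p : K.Realization) (S : Finset ι) (hS : p.1.support ⊆ S) :
    stdSimplex ℝ S :=
  ⟨fun v => p.1 v, fun v => p.2.1 v, by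
    rw [Finset.sum_coe_sort S fun v => p.1 v, p.sum_eq_one_of_subset hS]⟩

theorem simplexMap_toSimplex (σ : K.faces) (p : K.Realization) (hp : p.1.support ⊆ σ.1) :
    K.simplexMap σ (p.toSimplex σ.1 hp) = p := by
  refine Subtype.ext (Finsupp.ext fun v => ?_)
  by_cases hv : v ∈ σ.1
  · rw [simplexMap_apply_of_mem _ _ hv]; rfl
  · rw [simplexMap_apply_of_notMem _ _ hv]
    exact (Finsupp.notMem_support_iff.1 fun h => hv (hp h)).symm

theorem continuous_coord (v : ι) : Continuous fun p : K.Realization => p.1 v := by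
  refine continuous_realization_dom fun σ => ?_
  by_cases hv : v ∈ σ.1
  · simp only [simplexMap_apply_of_mem _ _ hv]
    exact (continuous_apply _).comp continuous_subtype_val
  · simp only [simplexMap_apply_of_notMem _ _ hv]
    exact continuous_const

/-- A map into `|K|` whose image involves only finitely many vertices is continuous as soon as its
coordinates are. -/
theorem continuous_of_coord {T : Type*} [TopologicalSpace T] {g : T → K.Realization}
    (V : Finset ι) (hV : ∀ t, (g t).1.support ⊆ V) (hc : ∀ v, Continuous fun t => (g t).1 v) :
    Continuous g := by
  classical
  let J := {ρ : V.powerset // ρ.1 ∈ K.faces}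
  let C : J → Set T := fun ρ => {t | (g t).1.support ⊆ ρ.1.1}
  -- Only finitely many faces lie in `V`; their closed sets `C ρ` cover `T`, and on each the map
  -- factors through one closed simplex.
  refine (locallyFinite_of_finite C).continuous ?_ ?_ ?_
  · refine Set.eq_univ_of_forall fun t => Set.mem_iUnion.2
      ⟨⟨⟨(g t).1.support, Finset.mem_powerset.2 (hV t)⟩, (g t).2.2.2⟩, ?_⟩
    exact Finset.Subset.refl _
  · intro ρ
    have : C ρ = ⋂ v ∈ {v | v ∉ ρ.1.1}, {t | (g t).1 v = 0} := by
      ext t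
      simp only [C, Set.mem_ofPred_eq, Set.mem_iInter, Finset.subset_iff, Finsupp.mem_support_iff]
      exact forall_congr' fun v => not_imp_comm
    rw [this]
    exact isClosed_biInter fun v _ => isClosed_eq (hc v) continuous_const
  · intro ρ
    rw [continuousOn_iff_continuous_domRestrict]
    have : (C ρ).domRestrict g = K.simplexMap ⟨ρ.1.1, ρ.2⟩ ∘
        fun t : C ρ => (g t).toSimplex ρ.1.1 t.2 := by
      funext t
      exact (simplexMap_toSimplex ⟨ρ.1.1, ρ.2⟩ (g t) t.2).symm
    rw [this]
    refine (continuous_simplexMap _).comp (Continuous.subtype_mk (continuous_pi fun v => ?_) _)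
    exact (hc v).comp continuous_subtype_val

/-- The interval is locally compact, so continuity of `h` can be tested on its curried form with
values in `C(unitInterval, T)`, a map out of `|K|` alone. -/
theorem continuous_prod_realization_dom {T : Type*} [TopologicalSpace T]
    {h : unitInterval × K.Realization → T}
    (hh : ∀ σ, Continuous fun q : unitInterval × stdSimplex ℝ σ.1 => h (q.1, K.simplexMap σ q.2)) :
    Continuous h := by
  have hc : ∀ p, Continuous fun t => h (t, p) := fun p => by
    have := (hh ⟨_, p.2.2.2⟩).comp
      (Continuous.prodMk_left (p.toSimplex _ (Finset.Subset.refl _)))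
    exact this.congr fun t => congrArg (fun z => h (t, z))
      (simplexMap_toSimplex ⟨_, p.2.2.2⟩ p (Finset.Subset.refl _))
  let G : K.Realization → C(unitInterval, T) := fun p => ⟨fun t => h (t, p), hc p⟩
  have hG : Continuous G := continuous_realization_dom fun σ =>
    (ContinuousMap.curry ⟨_, (hh σ).comp continuous_swap⟩).continuous
  exact (ContinuousMap.continuous_uncurry_of_continuous ⟨G, hG⟩).comp continuous_swap

/-! ### Maps and homotopies given by unnormalized weights. -/

theorem sum_pos_of_support_mem {u : ι →₀ ℝ} (h0 : ∀ v, 0 ≤ u v)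
    (hs : u.support ∈ K.faces) : 0 < u.sum fun _ a => a :=
  Finset.sum_pos (fun v hv => (h0 v).lt_of_ne (Finsupp.mem_support_iff.1 hv).symm)
    (K.isRelLowerSet_faces hs).1

/-- The point of `|K|` with barycentric coordinates proportional to the weights `u`. -/
noncomputable def ofWeights (K : PreAbstractSimplicialComplex ι) (u : ι →₀ ℝ) (h0 : ∀ v, 0 ≤ u v)
    (hs : u.support ∈ K.faces) : K.Realization :=
  ⟨(u.sum fun _ a => a)⁻¹ • u, by
    have hpos := sum_pos_of_support_mem h0 hs
    refine ⟨fun v => mul_nonneg (inv_nonneg.2 hpos.le) (h0 v), ?_, ?_⟩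
    · rw [Finsupp.sum_smul_index fun _ => rfl, ← Finsupp.mul_sum]
      exact inv_mul_cancel₀ hpos.ne'
    · rwa [Finsupp.support_smul_eq (inv_ne_zero hpos.ne')]⟩

/-- Total mass forces `a` to be the normalizing sum, so endpoints of homotopies need only be checked
up to a scalar. -/
theorem ofWeights_eq_of_smul {u : ι →₀ ℝ} (h0 : ∀ v, 0 ≤ u v) (hs : u.support ∈ K.faces)
    (p : K.Realization) (a : ℝ) (h : u = a • p.1) : K.ofWeights u h0 hs = p := by
  have hpos := sum_pos_of_support_mem h0 hs
  have hsum : (u.sum fun _ a => a) = a := by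
    rw [h, Finsupp.sum_smul_index fun _ => rfl, ← Finsupp.mul_sum, p.2.2.1, mul_one]
  refine Subtype.ext ?_
  change (u.sum fun _ a => a)⁻¹ • u = p.1
  rw [hsum] at hpos ⊢
  rw [h, smul_smul, inv_mul_cancel₀ hpos.ne', one_smul]

theorem continuous_ofWeights {u : unitInterval → K.Realization → ι →₀ ℝ} (h0 : ∀ t p v, 0 ≤ u t p v)
    (hs : ∀ t p, (u t p).support ∈ L.faces)
    (hu : ∀ σ ∈ K.faces, ∃ V : Finset ι, ∀ t, ∀ p : K.Realization, p.1.support ⊆ σ →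
      (u t p).support ⊆ V)
    (hc : ∀ σ : K.faces, ∀ v, Continuous fun q : unitInterval × stdSimplex ℝ σ.1 =>
      u q.1 (K.simplexMap σ q.2) v) :
    Continuous fun q : unitInterval × K.Realization => L.ofWeights (u q.1 q.2) (h0 _ _) (hs _ _) := by
  refine continuous_prod_realization_dom fun σ => ?_
  obtain ⟨V, hV⟩ := hu σ.1 σ.2
  have hV' := fun t w => hV t (K.simplexMap σ w) (support_simplexMap_subset σ w)
  refine continuous_of_coord V (fun q => ?_) fun v => ?_
  · exact Finsupp.support_smul.trans (hV' _ _)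
  · change Continuous fun q : unitInterval × stdSimplex ℝ σ.1 =>
      ((u q.1 (K.simplexMap σ q.2)).sum fun _ a => a)⁻¹ * u q.1 (K.simplexMap σ q.2) v
    refine Continuous.mul (Continuous.inv₀ ?_ fun q =>
      (sum_pos_of_support_mem (h0 _ _) (hs _ _)).ne') (hc σ v)
    have : (fun q : unitInterval × stdSimplex ℝ σ.1 => (u q.1 (K.simplexMap σ q.2)).sum fun _ a => a) =
        fun q => ∑ v ∈ V, u q.1 (K.simplexMap σ q.2) v := by
      funext q
      exact Finsupp.sum_of_support_subset _ (hV' _ _) _ fun _ _ => rfl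
    rw [this]
    exact continuous_finsetSum _ fun v _ => hc σ v

/-- A family of weights interpolating between two maps defines a homotopy. -/
theorem homotopic_of_weights {u : unitInterval → K.Realization → ι →₀ ℝ} (h0 : ∀ t p v, 0 ≤ u t p v)
    (hs : ∀ t p, (u t p).support ∈ L.faces)
    (hu : ∀ σ ∈ K.faces, ∃ V : Finset ι, ∀ t, ∀ p : K.Realization, p.1.support ⊆ σ →
      (u t p).support ⊆ V)
    (hc : ∀ σ : K.faces, ∀ v, Continuous fun q : unitInterval × stdSimplex ℝ σ.1 =>
      u q.1 (K.simplexMap σ q.2) v)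
    (a b : C(K.Realization, L.Realization)) (ha : ∀ p, ∃ c : ℝ, u 0 p = c • (a p).1)
    (hb : ∀ p, ∃ c : ℝ, u 1 p = c • (b p).1) : a.Homotopic b :=
  ⟨{ toFun := fun q => L.ofWeights (u q.1 q.2) (h0 _ _) (hs _ _)
     continuous_toFun := continuous_ofWeights h0 hs hu hc
     map_zero_left := fun p => ofWeights_eq_of_smul _ _ _ _ (ha p).choose_spec
     map_one_left := fun p => ofWeights_eq_of_smul _ _ _ _ (hb p).choose_spec }⟩

/-! ### Truncated coordinates and face weights. -/

namespace Realization

/-- The sum of the squares of the barycentric coordinates. -/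
noncomputable def sumSq (p : K.Realization) : ℝ := p.1.sum fun _ a => a ^ 2

theorem sumSq_eq_of_subset (p : K.Realization) {S : Finset ι} (hS : p.1.support ⊆ S) :
    p.sumSq = ∑ v ∈ S, p.1 v ^ 2 :=
  Finsupp.sum_of_support_subset _ hS _ fun _ _ => zero_pow two_ne_zero

theorem support_nonempty (p : K.Realization) : p.1.support.Nonempty :=
  (K.isRelLowerSet_faces p.2.2.2).1

theorem pos_of_mem_support (p : K.Realization) {v : ι} (hv : v ∈ p.1.support) : 0 < p.1 v :=
  (p.2.1 v).lt_of_ne (Finsupp.mem_support_iff.1 hv).symm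

theorem sumSq_pos (p : K.Realization) : 0 < p.sumSq :=
  Finset.sum_pos (fun _ hv => pow_pos (p.pos_of_mem_support hv) 2) p.support_nonempty

theorem continuous_sumSq : Continuous (sumSq : K.Realization → ℝ) := by
  refine continuous_realization_dom fun σ => ?_
  have : (fun w => (K.simplexMap σ w).sumSq) = fun w => ∑ v ∈ σ.1, (K.simplexMap σ w).1 v ^ 2 :=
    funext fun w => sumSq_eq_of_subset _ (support_simplexMap_subset σ w)
  rw [this]
  exact continuous_finsetSum _ fun v _ =>
    ((continuous_coord v).comp (continuous_simplexMap σ)).pow 2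

/-- `sumSq` is the average of the coordinates weighted by themselves, so it cannot exceed all of
them. Hence the cutoff `sumSq / 2` never removes every vertex. -/
theorem exists_sumSq_le (p : K.Realization) : ∃ v, p.sumSq ≤ p.1 v := by
  by_contra! h
  have h1 : ∑ v ∈ p.1.support, p.1 v ^ 2 < ∑ v ∈ p.1.support, p.1 v * p.sumSq :=
    Finset.sum_lt_sum_of_nonempty p.support_nonempty fun v hv => by
      rw [pow_two]
      exact mul_lt_mul_of_pos_left (h v) (p.pos_of_mem_support hv)
  rw [← Finset.sum_mul, p.sum_eq_one_of_subset (Finset.Subset.refl _), one_mul,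
    ← p.sumSq_eq_of_subset (Finset.Subset.refl _)] at h1
  exact h1.false

/-- The barycentric coordinates of `p` with small values cut off. -/
noncomputable def trunc (p : K.Realization) : ι →₀ ℝ :=
  Finsupp.onFinset p.1.support (fun v => max 0 (p.1 v - p.sumSq / 2)) fun v hv => by
    contrapose! hv
    rw [Finsupp.notMem_support_iff.1 hv]
    exact max_eq_left (by linarith [p.sumSq_pos])

theorem trunc_nonneg (p : K.Realization) (v : ι) : 0 ≤ p.trunc v := le_max_left _ _

theorem lt_of_trunc_ne_zero {p : K.Realization} {v : ι} (h : p.trunc v ≠ 0) :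
    p.sumSq / 2 < p.1 v := by
  contrapose! h
  exact max_eq_left (by linarith)

theorem support_trunc_subset (p : K.Realization) : p.trunc.support ⊆ p.1.support :=
  Finsupp.support_onFinset_subset

theorem support_trunc_nonempty (p : K.Realization) : p.trunc.support.Nonempty := by
  obtain ⟨v, hv⟩ := p.exists_sumSq_le
  refine ⟨v, Finsupp.mem_support_iff.2 (lt_max_of_lt_right ?_).ne'⟩
  linarith [p.sumSq_pos]

theorem support_trunc_mem (p : K.Realization) : p.trunc.support ∈ K.faces :=
  (K.isRelLowerSet_faces p.2.2.2).2 p.support_trunc_subset p.support_trunc_nonempty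

theorem continuous_trunc_apply (v : ι) : Continuous fun p : K.Realization => p.trunc v :=
  continuous_const.max ((continuous_coord v).sub (continuous_sumSq.div_const 2))

/-- A weight attached to the face `τ` of the simplex carrying `p`, which vanishes unless `τ`
contains all vertices at which `p.trunc` is positive. -/
noncomputable def faceWeight [DecidableEq ι] (p : K.Realization) (τ : Finset ι) : ℝ :=
  (∏ v ∈ τ, p.1 v) * ∏ v ∈ p.1.support \ τ, max 0 (1 - 2 * p.1 v / p.sumSq)

variable [DecidableEq ι]

theorem faceWeight_nonneg (p : K.Realization) (τ : Finset ι) : 0 ≤ p.faceWeight τ :=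
  mul_nonneg (Finset.prod_nonneg fun v _ => p.2.1 v) (Finset.prod_nonneg fun _ _ => le_max_left _ _)

/-- Vertices off the support contribute the factor `1`. On a closed simplex the product can thus be
taken over a fixed index set, as continuity requires. -/
theorem faceWeight_eq_of_subset (p : K.Realization) (τ : Finset ι) {S : Finset ι}
    (hS : p.1.support ⊆ S) : p.faceWeight τ =
      (∏ v ∈ τ, p.1 v) * ∏ v ∈ S \ τ, max 0 (1 - 2 * p.1 v / p.sumSq) := by
  refine congrArg _ (Finset.prod_subset (Finset.sdiff_subset_sdiff hS (Finset.Subset.refl _)) ?_)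
  intro v hv hv'
  have : v ∉ p.1.support := fun h =>
    hv' (Finset.mem_sdiff.2 ⟨h, (Finset.mem_sdiff.1 hv).2⟩)
  rw [Finsupp.notMem_support_iff.1 this]
  simp

theorem subset_of_faceWeight_ne_zero {p : K.Realization} {τ : Finset ι}
    (h : p.faceWeight τ ≠ 0) : τ ⊆ p.1.support := fun v hv => by
  rw [Finsupp.mem_support_iff]
  exact Finset.prod_ne_zero_iff.1 (left_ne_zero_of_mul h) v hv

/-- A vertex surviving truncation has `p.1 v > p.sumSq / 2`, so if it were missing from `τ` its
factor in the second product would be zero. -/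
theorem support_trunc_subset_of_faceWeight_ne_zero {p : K.Realization} {τ : Finset ι}
    (h : p.faceWeight τ ≠ 0) : p.trunc.support ⊆ τ := fun v hv => by
  by_contra hτ
  have h1 := Finset.prod_ne_zero_iff.1 (right_ne_zero_of_mul h) v
    (Finset.mem_sdiff.2 ⟨p.support_trunc_subset hv, hτ⟩)
  have h2 := lt_of_trunc_ne_zero (Finsupp.mem_support_iff.1 hv)
  refine h1 (max_eq_left ?_)
  have := (one_le_div p.sumSq_pos).2 (show p.sumSq ≤ 2 * p.1 v by linarith)
  linarith

theorem faceWeight_support_pos (p : K.Realization) : 0 < p.faceWeight p.1.support := by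
  rw [faceWeight, Finset.sdiff_self, Finset.prod_empty, mul_one]
  exact Finset.prod_pos fun v hv => p.pos_of_mem_support hv

theorem continuous_faceWeight (τ : Finset ι) :
    Continuous fun p : K.Realization => p.faceWeight τ := by
  refine continuous_realization_dom fun σ => ?_
  have : (fun w => (K.simplexMap σ w).faceWeight τ) = fun w =>
      (∏ v ∈ τ, (K.simplexMap σ w).1 v) * ∏ v ∈ σ.1 \ τ,
        max 0 (1 - 2 * (K.simplexMap σ w).1 v / (K.simplexMap σ w).sumSq) :=
    funext fun w => faceWeight_eq_of_subset _ _ (support_simplexMap_subset σ w)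
  rw [this]
  have hσ := continuous_simplexMap σ
  refine (continuous_finsetProd _ fun v _ => (continuous_coord v).comp hσ).mul
    (continuous_finsetProd _ fun v _ => continuous_const.max (continuous_const.sub
      ((continuous_const.mul ((continuous_coord v).comp hσ)).div
        (continuous_sumSq.comp hσ) fun w => (sumSq_pos _).ne')))

end Realization

/-! ### Truncation is homotopic to the identity. -/

theorem continuous_trunc_simplexMap (σ : K.faces) (v : ι) :
    Continuous fun q : unitInterval × stdSimplex ℝ σ.1 => (K.simplexMap σ q.2).trunc v :=
  (Realization.continuous_trunc_apply v).comp ((continuous_simplexMap σ).comp continuous_snd)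

theorem continuous_ofWeights_trunc_snd : Continuous fun q : unitInterval × K.Realization =>
    K.ofWeights q.2.trunc q.2.trunc_nonneg q.2.support_trunc_mem := by
  refine continuous_ofWeights (K := K) (L := K) (u := fun _ p => p.trunc)
    (fun _ p => p.trunc_nonneg) (fun _ p => p.support_trunc_mem) ?_ ?_
  · exact fun σ _ => ⟨σ, fun _ p hp => p.support_trunc_subset.trans hp⟩
  · exact continuous_trunc_simplexMap

theorem continuous_ofWeights_trunc : Continuous fun p : K.Realization =>
    K.ofWeights p.trunc p.trunc_nonneg p.support_trunc_mem := by
  have h0 : Continuous fun p : K.Realization => ((0 : unitInterval), p) :=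
    continuous_const.prodMk continuous_id
  have h := continuous_ofWeights_trunc_snd.comp h0
  exact h

/-- The self-map of `|K|` that forgets small barycentric coordinates. -/
noncomputable def truncMap (K : PreAbstractSimplicialComplex ι) :
    C(K.Realization, K.Realization) where
  toFun p := K.ofWeights p.trunc p.trunc_nonneg p.support_trunc_mem
  continuous_toFun := continuous_ofWeights_trunc

theorem trunc_eq_smul_truncMap (p : K.Realization) :
    p.trunc = (p.trunc.sum fun _ a => a) • (K.truncMap p).1 := by
  change p.trunc = (p.trunc.sum fun _ a => a) • (p.trunc.sum fun _ a => a)⁻¹ • p.trunc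
  rw [smul_smul, mul_inv_cancel₀ (sum_pos_of_support_mem p.trunc_nonneg p.support_trunc_mem).ne',
    one_smul]

/-- The straight-line homotopy works because truncation stays in the carrier of `p`. -/
theorem id_homotopic_truncMap :
    (ContinuousMap.id K.Realization).Homotopic K.truncMap := by
  have hsub : ∀ (t : unitInterval) (p : K.Realization),
      ((1 - (t : ℝ)) • p.1 + (t : ℝ) • p.trunc).support ⊆ p.1.support := by
    intro t p v hv
    by_contra h
    refine Finsupp.mem_support_iff.1 hv ?_
    rw [Finsupp.add_apply, Finsupp.smul_apply, Finsupp.smul_apply, Finsupp.notMem_support_iff.1 h,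
      Finsupp.notMem_support_iff.1 fun h' => h (p.support_trunc_subset h'), smul_zero, smul_zero,
      add_zero]
  refine homotopic_of_weights (u := fun t p => (1 - (t : ℝ)) • p.1 + (t : ℝ) • p.trunc)
    (fun t p v => ?_) (fun t p => ?_) (fun σ _ => ⟨σ, fun t p hp => (hsub t p).trans hp⟩)
    (fun σ v => ?_) _ _ (fun p => ⟨1, ?_⟩) fun p => ⟨p.trunc.sum fun _ a => a, ?_⟩
  · exact add_nonneg (mul_nonneg (sub_nonneg.2 t.2.2) (p.2.1 v))
      (mul_nonneg t.2.1 (p.trunc_nonneg v))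
  · refine (K.isRelLowerSet_faces p.2.2.2).2 (hsub t p) ?_
    obtain ⟨v, hv⟩ := p.support_trunc_nonempty
    refine ⟨v, Finsupp.mem_support_iff.2 (ne_of_gt ?_)⟩
    change 0 < (1 - (t : ℝ)) * p.1 v + t * p.trunc v
    have h1 := p.pos_of_mem_support (p.support_trunc_subset hv)
    have h2 := (p.trunc_nonneg v).lt_of_ne (Finsupp.mem_support_iff.1 hv).symm
    -- At `t = 0` the positivity comes from `p` itself, at later times from its truncation.
    rcases t.2.1.eq_or_lt with h | h
    · rw [← h]; simpa using h1
    · exact add_pos_of_nonneg_of_pos (mul_nonneg (sub_nonneg.2 t.2.2) h1.le) (mul_pos h h2)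
  · have ht : Continuous fun q : unitInterval × stdSimplex ℝ σ.1 => (q.1 : ℝ) :=
      continuous_subtype_val.comp continuous_fst
    have hp := (continuous_simplexMap σ).comp
      (continuous_snd : Continuous fun q : unitInterval × stdSimplex ℝ σ.1 => q.2)
    exact ((continuous_const.sub ht).mul ((continuous_coord v).comp hp)).add
      (ht.mul ((Realization.continuous_trunc_apply v).comp hp))
  · simp
  · simpa using trunc_eq_smul_truncMap p

/-! ### Simplicial maps. -/

theorem mapDomain_apply_eq_sum [DecidableEq ι] (φ : ι → ι) (u : ι →₀ ℝ) {S : Finset ι}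
    (hS : u.support ⊆ S) (v : ι) :
    u.mapDomain φ v = ∑ x ∈ S, if φ x = v then u x else 0 := by
  rw [Finsupp.mapDomain, Finsupp.sum_of_support_subset _ hS _ fun _ _ => Finsupp.single_zero _,
    Finsupp.finsetSum_apply]
  simp only [Finsupp.single_apply]

/-- The map of geometric realizations induced by a simplicial map. -/
noncomputable def realizationMap [DecidableEq ι] (φ : ι → ι)
    (hφ : ∀ σ ∈ K.faces, σ.image φ ∈ L.faces) : C(K.Realization, L.Realization) where
  toFun p := ⟨p.1.mapDomain φ, by
    have hsum : ((p.1.mapDomain φ).sum fun _ a => a) = 1 := by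
      rw [Finsupp.sum_mapDomain_index (fun _ => rfl) fun _ _ _ => rfl]
      exact p.2.2.1
    refine ⟨fun v => ?_, hsum, (L.isRelLowerSet_faces (hφ _ p.2.2.2)).2
      Finsupp.mapDomain_support ?_⟩
    · rw [mapDomain_apply_eq_sum φ p.1 (Finset.Subset.refl _)]
      exact Finset.sum_nonneg fun x _ => by
        split_ifs
        exacts [p.2.1 x, le_rfl]
    · rw [Finsupp.support_nonempty_iff]
      intro h
      rw [h, Finsupp.sum_zero_index] at hsum
      exact zero_ne_one hsum⟩
  continuous_toFun := by
    refine continuous_realization_dom fun σ => continuous_of_coord (σ.1.image φ) (fun w => ?_)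
      fun v => ?_
    · exact Finsupp.mapDomain_support.trans
        (Finset.image_subset_image (support_simplexMap_subset σ w))
    · have : (fun w => (K.simplexMap σ w).1.mapDomain φ v) =
          fun w => ∑ x ∈ σ.1, if φ x = v then (K.simplexMap σ w).1 x else 0 :=
        funext fun w => mapDomain_apply_eq_sum φ _ (support_simplexMap_subset σ w) v
      refine this ▸ continuous_finsetSum _ fun x _ => ?_
      split_ifs
      exacts [(continuous_coord x).comp (continuous_simplexMap σ), continuous_const]

/-! ### Moving vertices along tracks with face-dependent time grids. -/

section Track

variable (f : ι → ℝ → ι) (n : Finset ι → ℕ)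

/-- The indices `(x, τ, j)` with `x ∈ S`, `τ ⊆ S` and `j ≤ n τ`. -/
def trackIndex (S : Finset ι) : Finset (ι × (Σ _ : Finset ι, ℕ)) :=
  S ×ˢ S.powerset.sigma fun τ => Finset.range (n τ + 1)

theorem trackIndex_mono {S T : Finset ι} (h : S ⊆ T) : trackIndex n S ⊆ trackIndex n T :=
  Finset.product_subset_product h
    (Finset.sigma_mono (Finset.powerset_mono.2 h) fun _ => Finset.Subset.refl _)

variable [DecidableEq ι]

/-- The weight of the vertex `f x (j / n τ)` at time `t`. -/
noncomputable def trackWeight (t : ℝ) (p : K.Realization) (i : ι × (Σ _ : Finset ι, ℕ)) : ℝ :=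
  p.faceWeight i.2.1 * max 0 (1 - |n i.2.1 * t - i.2.2|) * p.trunc i.1

/-- At time `t` the mass of `p.trunc` at a vertex `x` is spread over vertices `f x d`
with `d` close to `t`. -/
noncomputable def track (t : ℝ) (p : K.Realization) : ι →₀ ℝ :=
  ∑ i ∈ trackIndex n p.1.support,
    Finsupp.single (f i.1 (i.2.2 / n i.2.1)) (trackWeight n t p i)

theorem trackWeight_nonneg (t : ℝ) (p : K.Realization) (i : ι × (Σ _ : Finset ι, ℕ)) :
    0 ≤ trackWeight n t p i :=
  mul_nonneg (mul_nonneg (p.faceWeight_nonneg _) (le_max_left _ _)) (p.trunc_nonneg _)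

/-- The added indices carry zero weight; a fixed index set on each closed simplex makes `track`
visibly continuous there. -/
theorem track_eq_of_subset (t : ℝ) (p : K.Realization) {S : Finset ι} (hS : p.1.support ⊆ S) :
    track f n t p = ∑ i ∈ trackIndex n S,
      Finsupp.single (f i.1 (i.2.2 / n i.2.1)) (trackWeight n t p i) := by
  refine Finset.sum_subset (trackIndex_mono n hS) fun i hi hi' => ?_
  rw [Finsupp.single_eq_zero]
  by_contra h
  refine hi' (Finset.mem_product.2 ⟨?_, Finset.mem_sigma.2 ⟨Finset.mem_powerset.2 ?_, ?_⟩⟩)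
  · exact p.support_trunc_subset (Finsupp.mem_support_iff.2 (right_ne_zero_of_mul h))
  · exact Realization.subset_of_faceWeight_ne_zero
      (left_ne_zero_of_mul (left_ne_zero_of_mul h))
  · exact (Finset.mem_sigma.1 (Finset.mem_product.1 hi).2).2

theorem track_apply (t : ℝ) (p : K.Realization) {S : Finset ι} (hS : p.1.support ⊆ S) (v : ι) :
    track f n t p v = ∑ i ∈ trackIndex n S,
      if f i.1 (i.2.2 / n i.2.1) = v then trackWeight n t p i else 0 := by
  rw [track_eq_of_subset f n t p hS, Finsupp.finsetSum_apply]
  simp only [Finsupp.single_apply]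

theorem track_nonneg (t : ℝ) (p : K.Realization) (v : ι) : 0 ≤ track f n t p v := by
  rw [track_apply f n t p (Finset.Subset.refl _)]
  refine Finset.sum_nonneg fun i _ => ?_
  split_ifs
  exacts [trackWeight_nonneg n t p i, le_rfl]

theorem exists_of_mem_support_track {t : ℝ} {p : K.Realization} {v : ι}
    (hv : v ∈ (track f n t p).support) : ∃ i ∈ trackIndex n p.1.support,
      f i.1 (i.2.2 / n i.2.1) = v ∧ trackWeight n t p i ≠ 0 := by
  rw [Finsupp.mem_support_iff, track_apply f n t p (Finset.Subset.refl _)] at hv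
  obtain ⟨i, hi, h⟩ := Finset.exists_ne_zero_of_sum_ne_zero hv
  exact ⟨i, hi, ite_ne_right_iff.1 h⟩

theorem support_track_nonempty {t : ℝ} (ht : t ∈ Set.Icc (0 : ℝ) 1) (p : K.Realization) :
    (track f n t p).support.Nonempty := by
  obtain ⟨x, hx⟩ := p.support_trunc_nonempty
  set τ := p.1.support with hτ
  -- The carrier has positive face weight, and the grid point just below `t` lies less than one step
  -- away, so its hat function is positive.
  let i : ι × (Σ _ : Finset ι, ℕ) := (x, ⟨τ, ⌊n τ * t⌋₊⟩)
  have hnt : 0 ≤ n τ * t := mul_nonneg (Nat.cast_nonneg _) ht.1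
  have hi : i ∈ trackIndex n τ := by
    refine Finset.mem_product.2 ⟨p.support_trunc_subset hx, Finset.mem_sigma.2
      ⟨Finset.mem_powerset.2 (Finset.Subset.refl _), Finset.mem_range.2 (Nat.lt_succ_of_le ?_)⟩⟩
    exact Nat.floor_le_of_le (mul_le_of_le_one_right (Nat.cast_nonneg _) ht.2)
  have hw : 0 < trackWeight n t p i := by
    refine mul_pos (mul_pos p.faceWeight_support_pos (lt_max_of_lt_right ?_))
      ((p.trunc_nonneg x).lt_of_ne (Finsupp.mem_support_iff.1 hx).symm)
    rw [sub_pos, abs_lt]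
    constructor
    · linarith [Nat.floor_le hnt]
    · linarith [Nat.lt_floor_add_one (n τ * t : ℝ)]
  refine ⟨f i.1 (i.2.2 / n i.2.1), Finsupp.mem_support_iff.2 (ne_of_gt ?_)⟩
  rw [track_apply f n t p (Finset.Subset.refl _)]
  refine Finset.sum_pos' (fun j _ => ?_) ⟨i, hi, ?_⟩
  · split_ifs
    exacts [trackWeight_nonneg n t p j, le_rfl]
  · rw [if_pos rfl]
    exact hw

/-- If at time `t` only indices with `f x (j / n τ) = φ x` contribute, then `track` is proportional
to the image of `p.trunc` under `φ`. -/
theorem exists_track_eq_smul (t : ℝ) (p : K.Realization) (φ : ι → ι)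
    (h : ∀ i ∈ trackIndex n p.1.support, trackWeight n t p i ≠ 0 →
      f i.1 (i.2.2 / n i.2.1) = φ i.1) :
    ∃ c : ℝ, track f n t p = c • p.trunc.mapDomain φ := by
  -- The face and time factors do not involve the vertex, so their sum is a common scalar.
  refine ⟨∑ j ∈ p.1.support.powerset.sigma fun τ => Finset.range (n τ + 1),
    p.faceWeight j.1 * max 0 (1 - |n j.1 * t - j.2|), ?_⟩
  have h1 : track f n t p = ∑ i ∈ trackIndex n p.1.support,
      Finsupp.single (φ i.1) (trackWeight n t p i) := by
    refine Finset.sum_congr rfl fun i hi => ?_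
    by_cases h0 : trackWeight n t p i = 0
    · rw [h0, Finsupp.single_zero, Finsupp.single_zero]
    · rw [h i hi h0]
  rw [h1, Finsupp.mapDomain, Finsupp.sum_of_support_subset _ p.support_trunc_subset _
    fun _ _ => Finsupp.single_zero _, trackIndex, Finset.sum_product, Finset.smul_sum]
  refine Finset.sum_congr rfl fun x _ => ?_
  rw [Finset.sum_smul]
  refine Finset.sum_congr rfl fun j _ => ?_
  rw [Finsupp.smul_single]
  rfl

theorem continuous_trackWeight_simplexMap (σ : K.faces) (i : ι × (Σ _ : Finset ι, ℕ)) :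
    Continuous fun q : unitInterval × stdSimplex ℝ σ.1 =>
      trackWeight n (q.1 : ℝ) (K.simplexMap σ q.2) i := by
  have ht : Continuous fun q : unitInterval × stdSimplex ℝ σ.1 => (q.1 : ℝ) :=
    continuous_subtype_val.comp continuous_fst
  have hw : Continuous fun q : unitInterval × stdSimplex ℝ σ.1 =>
      (K.simplexMap σ q.2).faceWeight i.2.1 :=
    (Realization.continuous_faceWeight i.2.1).comp ((continuous_simplexMap σ).comp continuous_snd)
  exact (hw.mul (continuous_const.max (continuous_const.sub
    ((continuous_const.mul ht).sub continuous_const).abs))).mul (continuous_trunc_simplexMap σ i.1)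

theorem continuous_track_simplexMap (σ : K.faces) (v : ι) :
    Continuous fun q : unitInterval × stdSimplex ℝ σ.1 =>
      track f n (q.1 : ℝ) (K.simplexMap σ q.2) v := by
  have : (fun q : unitInterval × stdSimplex ℝ σ.1 =>
      track f n (q.1 : ℝ) (K.simplexMap σ q.2) v) = fun q => ∑ i ∈ trackIndex n σ.1,
        if f i.1 (i.2.2 / n i.2.1) = v then trackWeight n (q.1 : ℝ) (K.simplexMap σ q.2) i else 0 :=
    funext fun q => track_apply f n _ _ (support_simplexMap_subset σ q.2) v
  refine this ▸ continuous_finsetSum _ fun i _ => ?_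
  split_ifs
  exacts [continuous_trackWeight_simplexMap n σ i, continuous_const]

/-- If for every face `σ` the vertices `f x d`, for `x ∈ σ` and `d` in an interval of length
depending on `σ`, span a face, then the simplicial map `f · 1` is homotopic to the identity. -/
theorem truncMap_homotopic_comp (hn : ∀ σ, 1 ≤ n σ) (hmono : ∀ σ τ, σ ⊆ τ → n σ ≤ n τ)
    (hface : ∀ σ ∈ K.faces, ∀ t ∈ Set.Icc (0 : ℝ) 1, ∀ ρ : Finset ι, ρ.Nonempty →
      (∀ v ∈ ρ, ∃ x ∈ σ, ∃ d ∈ Set.Icc (0 : ℝ) 1, |t - d| < 1 / n σ ∧ f x d = v) → ρ ∈ K.faces)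
    (h0 : ∀ x, f x 0 = x) (h1 : ∀ σ ∈ K.faces, σ.image (f · 1) ∈ K.faces) :
    K.truncMap.Homotopic ((realizationMap (f · 1) h1).comp K.truncMap) := by
  have hpos : ∀ τ, (0 : ℝ) < n τ := fun τ => Nat.cast_pos.2 (hn τ)
  have hnear : ∀ (t : ℝ) (p : K.Realization) (i), trackWeight n t p i ≠ 0 →
      |n i.2.1 * t - i.2.2| < 1 := fun t p i h => by
    have := right_ne_zero_of_mul (left_ne_zero_of_mul h)
    contrapose! this
    exact max_eq_left (by linarith)
  refine homotopic_of_weights (u := fun t p => track f n (t : ℝ) p)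
    (fun t p => track_nonneg f n t p) ?_ ?_ (continuous_track_simplexMap f n) _ _ ?_ ?_
  · intro t p
    -- The face used is the support of `p.trunc`, not of `p`: every contributing `τ` contains it, so
    -- by monotonicity of `n` the time error `1 / n τ` is within its tolerance.
    refine hface _ p.support_trunc_mem t t.2 _ (support_track_nonempty f n t.2 p) fun v hv => ?_
    obtain ⟨i, hi, hiv, hw⟩ := exists_of_mem_support_track f n hv
    have hτ := Realization.support_trunc_subset_of_faceWeight_ne_zero
      (left_ne_zero_of_mul (left_ne_zero_of_mul hw))
    refine ⟨i.1, Finsupp.mem_support_iff.2 (right_ne_zero_of_mul hw), _, ⟨?_, ?_⟩, ?_, hiv⟩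
    · exact div_nonneg (Nat.cast_nonneg _) (Nat.cast_nonneg _)
    · have hj := Finset.mem_range.1 (Finset.mem_sigma.1 (Finset.mem_product.1 hi).2).2
      exact (div_le_one (hpos _)).2 (Nat.cast_le.2 (Nat.lt_succ_iff.1 hj))
    · have hle : (1 : ℝ) / n i.2.1 ≤ 1 / n p.trunc.support :=
        one_div_le_one_div_of_le (hpos _) (Nat.cast_le.2 (hmono _ _ hτ))
      refine lt_of_lt_of_le ?_ hle
      have e : (t : ℝ) - i.2.2 / n i.2.1 = (n i.2.1 * t - i.2.2) / n i.2.1 := by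
        have := (hpos i.2.1).ne'
        field_simp
      rw [e, abs_div, abs_of_pos (hpos _)]
      exact div_lt_div_of_pos_right (hnear t p i hw) (hpos _)
  · refine fun σ _ => ⟨(trackIndex n σ).image fun i => f i.1 (i.2.2 / n i.2.1),
      fun t p hp v hv => ?_⟩
    obtain ⟨i, hi, hiv, -⟩ := exists_of_mem_support_track f n hv
    exact Finset.mem_image.2 ⟨i, trackIndex_mono n hp hi, hiv⟩
  · intro p
    obtain ⟨c, hc⟩ := exists_track_eq_smul f n 0 p id fun i hi hw => by
      have := hnear 0 p i hw
      rw [mul_zero, zero_sub, abs_neg, Nat.abs_cast] at this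
      -- At time `0` only the hat function centred at `0` is nonzero.
      have hj : i.2.2 = 0 := Nat.lt_one_iff.1 (by exact_mod_cast this)
      rw [hj, Nat.cast_zero, zero_div, h0, id]
    refine ⟨c * p.trunc.sum fun _ a => a, ?_⟩
    rw [mul_smul, ← trunc_eq_smul_truncMap]
    simpa using hc
  · intro p
    obtain ⟨c, hc⟩ := exists_track_eq_smul f n 1 p (f · 1) fun i hi hw => by
      have h := (abs_lt.1 (hnear 1 p i hw)).2
      have hj := Nat.lt_succ_iff.1
        (Finset.mem_range.1 (Finset.mem_sigma.1 (Finset.mem_product.1 hi).2).2)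
      -- At time `1` only the last grid point `j = n τ` remains.
      have h' : n i.2.1 < i.2.2 + 1 := by
        have : (n i.2.1 : ℝ) < i.2.2 + 1 := by linarith
        exact_mod_cast this
      rw [le_antisymm hj (Nat.lt_succ_iff.1 h'), div_self (hpos _).ne']
    refine ⟨c * p.trunc.sum fun _ a => a, ?_⟩
    change track f n ((1 : unitInterval) : ℝ) p =
      (c * p.trunc.sum fun _ a => a) • (K.truncMap p).1.mapDomain (f · 1)
    rw [mul_smul, ← Finsupp.mapDomain_smul, ← trunc_eq_smul_truncMap]
    simpa using hc

end Track

/-! ### From tracks to homotopy equivalences. -/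

/-- A criterion for the inclusion of a subcomplex to be a homotopy equivalence: the vertices move
along tracks `f x` ending in the subcomplex and fixing its vertices, and the short pieces of the
tracks of the vertices of a face span faces. -/
theorem isHomotopyEquivalence_realizationInclusion [DecidableEq ι] (hLK : L ≤ K) (f : ι → ℝ → ι)
    (h0 : ∀ x, f x 0 = x) (hL : ∀ σ ∈ L.faces, ∀ x ∈ σ, f x 1 = x)
    (h1L : ∀ σ ∈ K.faces, σ.image (f · 1) ∈ L.faces)
    (hface : ∀ σ ∈ K.faces, ∃ δ > 0, ∀ t ∈ Set.Icc (0 : ℝ) 1, ∀ ρ : Finset ι, ρ.Nonempty →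
      (∀ v ∈ ρ, ∃ x ∈ σ, ∃ d ∈ Set.Icc (0 : ℝ) 1, |t - d| < δ ∧ f x d = v) → ρ ∈ K.faces) :
    IsHomotopyEquivalence (realizationInclusion hLK) := by
  have h1K : ∀ σ ∈ K.faces, σ.image (f · 1) ∈ K.faces := fun σ hσ => hLK (h1L σ hσ)
  have hm : ∀ σ : Finset ι, ∃ m : ℕ, 1 ≤ m ∧ (σ ∈ K.faces → ∀ t ∈ Set.Icc (0 : ℝ) 1,
      ∀ ρ : Finset ι, ρ.Nonempty → (∀ v ∈ ρ, ∃ x ∈ σ, ∃ d ∈ Set.Icc (0 : ℝ) 1,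
        |t - d| < 1 / m ∧ f x d = v) → ρ ∈ K.faces) := by
    intro σ
    by_cases hσ : σ ∈ K.faces
    · obtain ⟨δ, hδ, h⟩ := hface σ hσ
      obtain ⟨m, hm⟩ := exists_nat_one_div_lt hδ
      refine ⟨m + 1, Nat.le_add_left _ _, fun _ t ht ρ hρ hv => h t ht ρ hρ fun v hvρ => ?_⟩
      obtain ⟨x, hx, d, hd, hlt, e⟩ := hv v hvρ
      exact ⟨x, hx, d, hd, hlt.trans (by exact_mod_cast hm), e⟩
    · exact ⟨1, le_rfl, fun h => (hσ h).elim⟩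
  choose m hm1 hm using hm
  -- Taking the supremum over all subsets makes the grid size monotone in the face without making it
  -- coarser.
  have hle : ∀ σ : Finset ι, m σ ≤ σ.powerset.sup m := fun σ =>
    Finset.le_sup (Finset.mem_powerset.2 (Finset.Subset.refl σ))
  have hH : K.truncMap.Homotopic ((realizationMap (f · 1) h1K).comp K.truncMap) := by
    refine truncMap_homotopic_comp f (fun σ => σ.powerset.sup m) (fun σ => (hm1 σ).trans (hle σ))
      (fun σ τ h => Finset.sup_mono (Finset.powerset_mono.2 h))
      (fun σ hσ t ht ρ hρ hv => hm σ hσ t ht ρ hρ fun v hvρ => ?_) h0 h1K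
    obtain ⟨x, hx, d, hd, hlt, e⟩ := hv v hvρ
    exact ⟨x, hx, d, hd, hlt.trans_le (one_div_le_one_div_of_le
      (Nat.cast_pos.2 (hm1 σ)) (Nat.cast_le.2 (hle σ))), e⟩
  -- With `φ` the end map and `T` the truncation, `id ≃ T ≃ φ ∘ T ≃ φ`.
  have hK : (ContinuousMap.id K.Realization).Homotopic (realizationMap (f · 1) h1K) :=
    (id_homotopic_truncMap.trans hH).trans
      (ContinuousMap.Homotopic.comp (ContinuousMap.Homotopic.refl (realizationMap (f · 1) h1K))
        (id_homotopic_truncMap (K := K)).symm)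
  refine ⟨⟨realizationInclusion hLK, realizationMap (f · 1) h1L, ?_, ?_⟩, rfl⟩
  · have : (realizationMap (f · 1) h1L).comp (realizationInclusion hLK) =
        ContinuousMap.id L.Realization := by
      refine ContinuousMap.ext fun p => Subtype.ext ?_
      change p.1.mapDomain (f · 1) = p.1
      rw [Finsupp.mapDomain_congr (g := id) fun x hx => hL _ p.2.2.2 x hx, Finsupp.mapDomain_id]
    rw [this]
  · exact hK.symm

end PreAbstractSimplicialComplex

/-! ### Tracks of a deformation contraction in Rips and Čech complexes. -/

namespace IsDeformationContraction

variable {X : Type*} [MetricSpace X] {A : Set X} {F : C(X × unitInterval, X)}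

theorem dist_le_of_le (hF : IsDeformationContraction A F) (x y : X) {t t' : unitInterval}
    (h : t ≤ t') : dist (F (x, t')) (F (y, t')) ≤ dist (F (x, t)) (F (y, t)) := by
  rcases h.eq_or_lt with rfl | h
  · exact le_rfl
  · exact hF.dist_le x y t t' h

theorem dist_apply_le (hF : IsDeformationContraction A F) (x y : X) (t : unitInterval) :
    dist (F (x, t)) (F (y, t)) ≤ dist x y := by
  simpa only [hF.apply_zero] using hF.dist_le_of_le x y (show 0 ≤ t from t.2.1)

/-- The track of a point under a deformation contraction, as a function of a real parameter. -/
noncomputable def track (F : C(X × unitInterval, X)) (x : X) (t : ℝ) : X :=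
  F (x, Set.projIcc 0 1 zero_le_one t)

theorem track_eq (x : X) {t : ℝ} (ht : t ∈ Set.Icc (0 : ℝ) 1) : track F x t = F (x, ⟨t, ht⟩) := by
  rw [track, Set.projIcc_of_mem]

theorem track_zero (hF : IsDeformationContraction A F) (x : X) : track F x 0 = x := by
  rw [track_eq x ⟨le_rfl, zero_le_one⟩]
  exact hF.apply_zero x

theorem track_one_mem (hF : IsDeformationContraction A F) (x : X) : track F x 1 ∈ A := by
  rw [track_eq x ⟨zero_le_one, le_rfl⟩]
  exact hF.apply_one_mem x

theorem track_of_mem (hF : IsDeformationContraction A F) {x : X} (hx : x ∈ A) (t : ℝ) :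
    track F x t = x :=
  hF.apply_of_mem x hx _

theorem dist_track_le (hF : IsDeformationContraction A F) (x y : X) (t : ℝ) :
    dist (track F x t) (track F y t) ≤ dist x y :=
  hF.dist_apply_le x y _

/-- The tracks of the points of `s` form one curve in a finite power of `X`, uniformly continuous on
the compact interval. -/
theorem exists_forall_dist_track_lt (F : C(X × unitInterval, X)) (s : Finset X) {ε : ℝ}
    (hε : 0 < ε) : ∃ δ > 0, ∀ x ∈ s, ∀ t ∈ Set.Icc (0 : ℝ) 1, ∀ d ∈ Set.Icc (0 : ℝ) 1,
      |t - d| < δ → dist (track F x t) (track F x d) < ε := by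
  have hc : Continuous fun (t : unitInterval) (x : s) => F (x.1, t) :=
    continuous_pi fun x => F.continuous.comp (continuous_const.prodMk continuous_id)
  obtain ⟨δ, hδ, h⟩ := Metric.uniformContinuous_iff.1
    (CompactSpace.uniformContinuous_of_continuous hc) ε hε
  refine ⟨δ, hδ, fun x hx t ht d hd htd => ?_⟩
  rw [track_eq x ht, track_eq x hd]
  exact (dist_pi_lt_iff hε).1 (h (a := ⟨t, ht⟩) (b := ⟨d, hd⟩) htd) ⟨x, hx⟩

theorem rips_short_tracks (hF : IsDeformationContraction A F) {r : ℝ}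
    {s : Finset X} (hs : s ∈ (ripsComplex (Set.univ : Set X) r).faces) :
    ∃ δ > 0, ∀ t ∈ Set.Icc (0 : ℝ) 1, ∀ ρ : Finset X, ρ.Nonempty →
      (∀ v ∈ ρ, ∃ x ∈ s, ∃ d ∈ Set.Icc (0 : ℝ) 1, |t - d| < δ ∧ track F x d = v) →
      ρ ∈ (ripsComplex (Set.univ : Set X) r).faces := by
  -- Two time errors, one at each endpoint, use up half of the gap between the diameter and `r`.
  have hε : 0 < (r - Metric.diam (s : Set X)) / 4 := by linarith [hs.2.2]
  obtain ⟨δ, hδ, h⟩ := exists_forall_dist_track_lt F s hε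
  refine ⟨δ, hδ, fun t ht ρ hρ hv => ⟨hρ, Set.subset_univ _, ?_⟩⟩
  refine lt_of_le_of_lt (Metric.diam_le_of_forall_dist_le
    (C := (Metric.diam (s : Set X) + r) / 2) ?_ ?_) (by linarith)
  · linarith [Metric.diam_nonneg (s := (s : Set X))]
  · intro a ha b hb
    obtain ⟨x, hx, d, hd, htd, rfl⟩ := hv a ha
    obtain ⟨y, hy, e, he, hte, rfl⟩ := hv b hb
    have h1 := h x hx t ht d hd htd
    have h2 := h y hy t ht e he hte
    have h3 := (hF.dist_track_le x y t).trans
      (Metric.dist_le_diam_of_mem s.finite_toSet.isBounded hx hy)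
    have h4 := dist_triangle4 (track F x d) (track F x t) (track F y t) (track F y e)
    rw [dist_comm] at h1
    linarith

/-- The witness travels along its own track, staying as close to the moving vertices as it was at
the start; finiteness of `s` leaves a positive gap below `r` for the time errors. -/
theorem cech_short_tracks (hF : IsDeformationContraction A F) {r : ℝ}
    {s : Finset X} (hs : s ∈ (cechComplex (Set.univ : Set X) Set.univ r).faces) :
    ∃ δ > 0, ∀ t ∈ Set.Icc (0 : ℝ) 1, ∀ ρ : Finset X, ρ.Nonempty →
      (∀ v ∈ ρ, ∃ x ∈ s, ∃ d ∈ Set.Icc (0 : ℝ) 1, |t - d| < δ ∧ track F x d = v) →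
      ρ ∈ (cechComplex (Set.univ : Set X) Set.univ r).faces := by
  obtain ⟨hne, -, w, -, hw⟩ := hs
  obtain ⟨z, hz, hmax⟩ := s.exists_max_image (dist w) hne
  rw [Set.mem_iInter₂] at hw
  have hε : 0 < r - dist w z := sub_pos.2 (hw z hz)
  obtain ⟨δ, hδ, h⟩ := exists_forall_dist_track_lt F s hε
  refine ⟨δ, hδ, fun t ht ρ hρ hv => ⟨hρ, Set.subset_univ _, track F w t, trivial, ?_⟩⟩
  rw [Set.mem_iInter₂]
  intro v hvρ
  obtain ⟨x, hx, d, hd, htd, rfl⟩ := hv v hvρ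
  have h1 := h x hx t ht d hd htd
  have h2 := hF.dist_track_le w x t
  have h3 := hmax x hx
  have h4 := dist_triangle (track F w t) (track F x t) (track F x d)
  rw [Metric.mem_ball]
  linarith

theorem image_track_one_mem_rips [DecidableEq X] (hF : IsDeformationContraction A F) {r : ℝ}
    {s : Finset X} (hs : s ∈ (ripsComplex (Set.univ : Set X) r).faces) :
    s.image (track F · 1) ∈ (ripsComplex A r).faces := by
  refine ⟨hs.1.image _, ?_, lt_of_le_of_lt
    (Metric.diam_le_of_forall_dist_le Metric.diam_nonneg ?_) hs.2.2⟩
  · rw [Finset.coe_image]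
    exact Set.image_subset_iff.2 fun x _ => hF.track_one_mem x
  · rw [Finset.coe_image]
    rintro _ ⟨x, hx, rfl⟩ _ ⟨y, hy, rfl⟩
    exact (hF.dist_track_le x y 1).trans
      (Metric.dist_le_diam_of_mem s.finite_toSet.isBounded hx hy)

theorem image_track_one_mem_cech [DecidableEq X] (hF : IsDeformationContraction A F) {r : ℝ}
    {s : Finset X} (hs : s ∈ (cechComplex (Set.univ : Set X) Set.univ r).faces) :
    s.image (track F · 1) ∈ (cechComplex A A r).faces := by
  obtain ⟨hne, -, w, -, hw⟩ := hs
  rw [Set.mem_iInter₂] at hw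
  refine ⟨hne.image _, ?_, track F w 1, hF.track_one_mem w, ?_⟩
  · rw [Finset.coe_image]
    exact Set.image_subset_iff.2 fun x _ => hF.track_one_mem x
  · rw [Set.mem_iInter₂]
    intro v hv
    obtain ⟨x, hx, rfl⟩ := Finset.mem_image.1 hv
    exact (hF.dist_track_le w x 1).trans_lt (hw x hx)

end IsDeformationContraction

theorem proposition3p2 {X : Type*} [MetricSpace X] (A : Set X)
    (hA : DeformationContracts X A) (r : ℝ) (hr : 0 < r) :
    IsHomotopyEquivalence
      (PreAbstractSimplicialComplex.realizationInclusion
        (ripsComplex_mono (Set.subset_univ A) r :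
          ripsComplex A r ≤ ripsComplex Set.univ r)) ∧
    IsHomotopyEquivalence
      (PreAbstractSimplicialComplex.realizationInclusion
        (cechComplex_mono (Set.subset_univ A) (Set.subset_univ A) r :
          cechComplex A A r ≤ cechComplex Set.univ Set.univ r)) ∧
    IsHomotopyEquivalence
      (PreAbstractSimplicialComplex.realizationInclusion
        (cechComplex_mono (Set.Subset.refl Set.univ) (Set.subset_univ A) r :
          cechComplex Set.univ A r ≤ cechComplex Set.univ Set.univ r)) := by
  classical
  obtain ⟨F, hF⟩ := hA
  refine ⟨?_, ?_, ?_⟩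
  · exact PreAbstractSimplicialComplex.isHomotopyEquivalence_realizationInclusion _ (IsDeformationContraction.track F)
      hF.track_zero (fun s hs x hx => hF.track_of_mem (hs.2.1 hx) 1)
      (fun s hs => hF.image_track_one_mem_rips hs) fun s hs => hF.rips_short_tracks hs
  · exact PreAbstractSimplicialComplex.isHomotopyEquivalence_realizationInclusion _ (IsDeformationContraction.track F)
      hF.track_zero (fun s hs x hx => hF.track_of_mem (hs.2.1 hx) 1)
      (fun s hs => hF.image_track_one_mem_cech hs) fun s hs => hF.cech_short_tracks hs
  · exact PreAbstractSimplicialComplex.isHomotopyEquivalence_realizationInclusion _ (IsDeformationContraction.track F)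
      hF.track_zero (fun s hs x hx => hF.track_of_mem (hs.2.1 hx) 1)
      -- The end map already has witnesses in `A`, which serve as witnesses in `X`.
      (fun s hs => cechComplex_mono (Set.subset_univ A) le_rfl r (hF.image_track_one_mem_cech hs))
      fun s hs => hF.cech_short_tracks hs
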